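/- **Theorem (Universality of signature kernels).** Let $V$ be a finite-dimensional real inner product space, and give each $V^{\otimes k}$ the Hilbert–Schmidt inner product $\langle v_1\cdots v_k, w_1\cdots w_k\rangle_{V^{\otimes k}}=\prod_i\langle v_i,w_i\rangle_V$ (with $V^{\otimes 0}=\mathbb R$). Let $[a,b]$ be a closed interval and let $C_{0,1}([a,b],V)$ be the set of continuous paths $x:[a,b]\to V$ of bounded variation with $x_a=0$. The signature of $x$ is $$S(x)=\bigl(S(x)^{(k)}\bigr)_{k\ge 0}\in T((V)):=\prod_{k\ge0}V^{\otimes k},\qquad S(x)^{(0)}=1,\quad S(x)^{(k)}=\int_{a<t_1<\dots<t_k<b}dx_{t_1}\otimes\cdots\otimes dx_{t_k}.$$ Let $\mathcal C$ be the space of unparameterised paths, i.e. the quotient of $C_{0,1}([a,b],V)$ by the relation $x\sim y\iff S(x)=S(y)$; the signature descends to a map $S:\mathcal C\to T((V))$. Let $\phi:\mathbb N\cup\{0\}\to(0,\infty)$ be a weight function such that $\sum_{k\ge0}\frac{C^k\phi(k)}{(k!)^2}<\infty$ for every $C>0$, and let $T_\phi((V))$ be the Hilbert space completion of $\bigoplus_k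 V^{\otimes k}$ for $\langle v,w\rangle_\phi=\sum_k\phi(k)\langle v_k,w_k\rangle_{V^{\otimes k}}$, that is, the space of all $v\in T((V))$ with $\sum_k\phi(k)\|v_k\|^2<\infty$, with its norm topology. Then $S(\gamma)\in T_\phi((V))$ for every $\gamma\in\mathcal C$. Moreover, if $\mathcal C$ is equipped with any topology for which $S:\mathcal C\to T_\phi((V))$ is continuous, then the $\phi$-signature kernel $$k_\phi:\mathcal C\times\mathcal C\to\mathbb R,\qquad k_\phi(\gamma,\sigma)=\langle S(\gamma),S(\sigma)\rangle_\phi ,$$ is universal (cc-universal): $k_\phi$ is continuous on $\mathcal C\times\mathcal C$, symmetric and positive (semi)definite, and for every compact $\mathcal K\subset\mathcal C$ the linear span of the functions $k_\phi(\gamma,\cdot)|_{\mathcal K}$, $\gamma\in\mathcal K$, is dense in $C(\mathcal K)$ for the topology of uniform convergence. -/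

import Mathlib

universe u

open scoped TensorProduct

noncomputable section

namespace SigKernel

/-! ### Tensor powers with the Hilbert–Schmidt inner product -/

/-- A real inner product space, bundled: used only to define the tensor powers by recursion. -/
structure BundledIPS : Type (u + 1) where
  carrier : Type u
  [grp : NormedAddCommGroup carrier]
  [ips : InnerProductSpace ℝ carrier]

attribute [instance] BundledIPS.grp BundledIPS.ips

/-- The recursion `V^{⊗0} = ℝ`, `V^{⊗(k+1)} = V^{⊗k} ⊗ V`. The tensor product carries Mathlib's
Hilbert–Schmidt inner product `⟪v ⊗ a, w ⊗ b⟫ = ⟪v, w⟫ * ⟪a, b⟫`. The line `ℝ` is realised, in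
the universe of `V`, as the one-dimensional Euclidean space `EuclideanSpace ℝ PUnit`. -/
def tpowBundled (V : Type u) [NormedAddCommGroup V] [InnerProductSpace ℝ V] : ℕ → BundledIPS.{u}
  | 0 => ⟨EuclideanSpace ℝ PUnit.{u + 1}⟩
  | k + 1 => ⟨(tpowBundled V k).carrier ⊗[ℝ] V⟩

variable (V : Type u) [NormedAddCommGroup V] [InnerProductSpace ℝ V]

/-- The tensor power `V^{⊗k}`. -/
def TPow (k : ℕ) : Type u := (tpowBundled V k).carrier

instance (k : ℕ) : NormedAddCommGroup (TPow V k) := (tpowBundled V k).grp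

instance (k : ℕ) : InnerProductSpace ℝ (TPow V k) := (tpowBundled V k).ips

/-- The unit `1 ∈ V^{⊗0} = ℝ`. -/
def tpowOne : TPow V 0 := (EuclideanSpace.single PUnit.unit 1 : EuclideanSpace ℝ PUnit.{u + 1})

/-- The bilinear map `V^{⊗k} × V → V^{⊗(k+1)}`, `(v, a) ↦ v ⊗ a`. -/
def tpowSnoc (k : ℕ) : TPow V k →L[ℝ] V →L[ℝ] TPow V (k + 1) :=
  TensorProduct.mkL ℝ (tpowBundled V k).carrier V

/-- `⟪1, 1⟫ = 1` in `V^{⊗0}`. -/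
theorem inner_tpowOne : inner ℝ (tpowOne V) (tpowOne V) = 1 := by
  change inner ℝ (EuclideanSpace.single PUnit.unit 1 : EuclideanSpace ℝ PUnit.{u + 1})
    (EuclideanSpace.single PUnit.unit 1) = 1
  simp

/-- The defining property of the Hilbert–Schmidt inner product. -/
theorem inner_tpowSnoc (k : ℕ) (v w : TPow V k) (a b : V) :
    inner ℝ (tpowSnoc V k v a) (tpowSnoc V k w b) = inner ℝ v w * inner ℝ a b :=
  TensorProduct.inner_tmul ℝ (E := (tpowBundled V k).carrier) v w a b

instance [FiniteDimensional ℝ V] (k : ℕ) : FiniteDimensional ℝ (TPow V k) := by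
  induction k with
  | zero => exact inferInstanceAs (FiniteDimensional ℝ (EuclideanSpace ℝ PUnit.{u + 1}))
  | succ k ih =>
    have : FiniteDimensional ℝ (tpowBundled V k).carrier := ih
    exact inferInstanceAs (FiniteDimensional ℝ ((tpowBundled V k).carrier ⊗[ℝ] V))

/-- The space `T((V)) = ∏_k V^{⊗k}` of formal tensor series. -/
def TensorSeries : Type u := (k : ℕ) → TPow V k

/-! ### The weighted Hilbert spaces `T_φ((V))` -/

/-- A weight function `φ : ℕ → (0, ∞)`. -/
structure Weight where
  val : ℕ → ℝ
  pos : ∀ k, 0 < val k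

instance : CoeFun Weight (fun _ => ℕ → ℝ) := ⟨Weight.val⟩

variable {V} in
/-- Membership in `T_φ((V))`: `∑ φ(k) ‖v_k‖² < ∞`. -/
def MemWeighted (φ : Weight) (v : TensorSeries V) : Prop :=
  Summable fun k => φ k * ‖v k‖ ^ 2

variable {V} in
theorem MemWeighted.summable_inner {φ : Weight} {v w : TensorSeries V}
    (hv : MemWeighted φ v) (hw : MemWeighted φ w) :
    Summable fun k => φ k * inner ℝ (v k) (w k) := by
  refine Summable.of_norm_bounded (hv.add hw) fun k => ?_
  have h0 := φ.pos k
  have h1 : |inner ℝ (v k) (w k)| ≤ ‖v k‖ * ‖w k‖ := abs_real_inner_le_norm _ _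
  rw [Real.norm_eq_abs, abs_mul, abs_of_pos h0, ← mul_add]
  refine mul_le_mul_of_nonneg_left ?_ h0.le
  nlinarith [sq_nonneg (‖v k‖ - ‖w k‖), sq_nonneg ‖v k‖, sq_nonneg ‖w k‖]

/-- The vector subspace `{v ∈ T((V)) : ∑ φ(k) ‖v_k‖² < ∞}` of `∏_k V^{⊗k}`. -/
def weightedSubmodule (φ : Weight) : Submodule ℝ ((k : ℕ) → TPow V k) where
  carrier := {v | MemWeighted φ (v : TensorSeries V)}
  zero_mem' := by simp [MemWeighted]
  add_mem' {v w} hv hw := by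
    have h := (hv.add hw).mul_left 2
    refine Summable.of_nonneg_of_le (fun k => ?_) (fun k => ?_) h
    · have := φ.pos k
      positivity
    · have h0 := φ.pos k
      have h1 : ‖v k + w k‖ ≤ ‖v k‖ + ‖w k‖ := norm_add_le _ _
      have h2 : ‖v k + w k‖ ^ 2 ≤ 2 * (‖v k‖ ^ 2 + ‖w k‖ ^ 2) := by
        nlinarith [sq_nonneg (‖v k‖ - ‖w k‖), norm_nonneg (v k + w k)]
      calc φ k * ‖v k + w k‖ ^ 2 ≤ φ k * (2 * (‖v k‖ ^ 2 + ‖w k‖ ^ 2)) :=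
            mul_le_mul_of_nonneg_left h2 h0.le
        _ = 2 * (φ k * ‖v k‖ ^ 2 + φ k * ‖w k‖ ^ 2) := by ring
  smul_mem' c v hv := by
    have h := Summable.mul_left (c ^ 2) hv
    refine h.congr fun k => ?_
    simp only [Pi.smul_apply, norm_smul, Real.norm_eq_abs, mul_pow, sq_abs]
    ring

/-- The Hilbert space `T_φ((V))`: the completion of the tensor algebra `⨁_k V^{⊗k}` for the inner
product `⟪v, w⟫_φ = ∑ φ(k) ⟪v_k, w_k⟫`, realised as the space of the tensor series `v` with
`∑ φ(k) ‖v_k‖² < ∞`. Its topology is that of the norm defined below. -/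
def WeightedTensors (φ : Weight) : Type u := weightedSubmodule V φ

namespace WeightedTensors

variable {V} {φ : Weight}

instance : AddCommGroup (WeightedTensors V φ) :=
  inferInstanceAs (AddCommGroup (weightedSubmodule V φ))

instance : Module ℝ (WeightedTensors V φ) :=
  inferInstanceAs (Module ℝ (weightedSubmodule V φ))

/-- A tensor series in `T_φ((V))`, as an element of that space. -/
def mk (v : TensorSeries V) (hv : MemWeighted φ v) : WeightedTensors V φ := ⟨v, hv⟩

/-- The component in `V^{⊗k}`. -/
def coeff (v : WeightedTensors V φ) (k : ℕ) : TPow V k := v.1 k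

theorem memWeighted (v : WeightedTensors V φ) : MemWeighted φ (fun k => v.coeff k) := v.2

@[simp] theorem coeff_mk (v : TensorSeries V) (hv : MemWeighted φ v) (k : ℕ) :
    (mk v hv).coeff k = v k := rfl

@[simp] theorem coeff_add (v w : WeightedTensors V φ) (k : ℕ) :
    (v + w).coeff k = v.coeff k + w.coeff k := rfl

@[simp] theorem coeff_smul (c : ℝ) (v : WeightedTensors V φ) (k : ℕ) :
    (c • v).coeff k = c • v.coeff k := rfl

theorem ext_coeff {v w : WeightedTensors V φ} (h : ∀ k, v.coeff k = w.coeff k) : v = w :=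
  Subtype.ext (funext h)

/-- The `φ`-inner product `⟪v, w⟫_φ = ∑ φ(k) ⟪v_k, w_k⟫`. -/
instance : Inner ℝ (WeightedTensors V φ) :=
  ⟨fun v w => ∑' k, φ k * inner ℝ (v.coeff k) (w.coeff k)⟩

theorem inner_def (v w : WeightedTensors V φ) :
    inner ℝ v w = ∑' k, φ k * inner ℝ (v.coeff k) (w.coeff k) := rfl

theorem summable_inner (v w : WeightedTensors V φ) :
    Summable fun k => φ k * inner ℝ (v.coeff k) (w.coeff k) :=
  v.memWeighted.summable_inner w.memWeighted

theorem inner_term_nonneg (v : WeightedTensors V φ) (k : ℕ) :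
    0 ≤ φ k * inner ℝ (v.coeff k) (v.coeff k) :=
  mul_nonneg (φ.pos k).le real_inner_self_nonneg

/-- The axioms of an inner product. -/
@[reducible] def innerCore : InnerProductSpace.Core ℝ (WeightedTensors V φ) where
  conj_inner_symm v w := by
    simp only [inner_def, conj_trivial]
    exact tsum_congr fun k => by rw [real_inner_comm]
  re_inner_nonneg v := by
    simp only [inner_def, RCLike.re_to_real]
    exact tsum_nonneg v.inner_term_nonneg
  add_left v w z := by
    simp only [inner_def, coeff_add, inner_add_left, mul_add]
    exact (summable_inner v z).tsum_add (summable_inner w z)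
  smul_left v w c := by
    simp only [inner_def, coeff_smul, real_inner_smul_left, conj_trivial]
    rw [← tsum_mul_left]
    exact tsum_congr fun k => by ring
  definite v hv := by
    rw [inner_def] at hv
    have h := (hasSum_zero_iff_of_nonneg v.inner_term_nonneg).1 (hv ▸ (summable_inner v v).hasSum)
    refine ext_coeff fun k => ?_
    have hk := congrFun h k
    simp only [Pi.zero_apply, mul_eq_zero, (φ.pos k).ne', false_or] at hk
    exact inner_self_eq_zero.1 hk

instance : NormedAddCommGroup (WeightedTensors V φ) := innerCore.toNormedAddCommGroup

instance : InnerProductSpace ℝ (WeightedTensors V φ) := .ofCore innerCore.toCore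

end WeightedTensors

/-! ### Paths, signatures, unparameterised paths -/

variable {a b : ℝ}

/-- The space `C_{0,1}([a,b], V)` of continuous paths `[a,b] → V` of bounded variation (finite
length) which start at `0`. -/
structure BVPath (hab : a ≤ b) where
  toFun : Set.Icc a b → V
  continuous : Continuous toFun
  boundedVariation : BoundedVariationOn toFun Set.univ
  start : toFun ⟨a, Set.left_mem_Icc.2 hab⟩ = 0

namespace BVPath

variable {V} {hab : a ≤ b}

/-- The path, continued to `ℝ` by its constant end values. -/
def extend (x : BVPath V hab) : ℝ → V := Set.IccExtend hab x.toFun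

theorem boundedVariationOn_extend (x : BVPath V hab) : BoundedVariationOn x.extend Set.univ :=
  ne_top_of_le_ne_top x.boundedVariation
    (eVariationOn.comp_le_of_monotoneOn x.toFun (Set.projIcc a b hab)
      (Set.monotone_projIcc hab |>.monotoneOn _) fun _ _ => Set.mem_univ _)

variable [FiniteDimensional ℝ V]

/-- The `V`-valued Lebesgue–Stieltjes measure `dx`, with mass `x_t - x_s` on `(s, t]`. -/
def measure (x : BVPath V hab) : MeasureTheory.VectorMeasure ℝ V :=
  haveI : CompleteSpace V := FiniteDimensional.complete ℝ V
  x.boundedVariationOn_extend.vectorMeasure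

/-- The iterated integrals `S(x)^{(k)}_{[a,t]} = ∫_{a < t₁ < ⋯ < t_k < t} dx_{t₁} ⋯ dx_{t_k}` in
`V^{⊗k}`: one has `S(x)^{(0)} = 1` and `S(x)^{(k+1)}_{[a,t]} = ∫_a^t S(x)^{(k)}_{[a,s]} ⊗ dx_s`. -/
def iteratedIntegral (x : BVPath V hab) : (k : ℕ) → ℝ → TPow V k
  | 0 => fun _ => tpowOne V
  | k + 1 => fun t =>
      (x.measure.restrict (Set.Ioc a t)).integral (iteratedIntegral x k) (tpowSnoc V k)

/-- The signature transform `S(x) = (S(x)^{(k)}_{[a,b]})_k`. -/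
def signature (x : BVPath V hab) : TensorSeries V := fun k => x.iteratedIntegral k b

end BVPath

variable [FiniteDimensional ℝ V]

/-- The space of unparameterised paths: the quotient of `C_{0,1}([a,b], V)` by equality of
signatures. -/
def UnparamPath (hab : a ≤ b) : Type u :=
  Quotient (Setoid.ker (BVPath.signature : BVPath V hab → TensorSeries V))

namespace UnparamPath

variable {V} {hab : a ≤ b}

/-- The signature transform on unparameterised paths. -/
def signature (γ : UnparamPath V hab) : TensorSeries V :=
  Quotient.lift BVPath.signature (fun _ _ h => h) γ

end UnparamPath

variable {V} {hab : a ≤ b}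

/-- The signature transform as a map into `T_φ((V))`, once its values are known to lie there. -/
def weightedSignature (φ : Weight) (hS : ∀ γ : UnparamPath V hab, MemWeighted φ γ.signature)
    (γ : UnparamPath V hab) : WeightedTensors V φ :=
  WeightedTensors.mk γ.signature (hS γ)

/-- The `φ`-signature kernel `k_φ(γ, σ) = ⟪S(γ), S(σ)⟫_φ`. -/
def signatureKernel (φ : Weight) (hS : ∀ γ : UnparamPath V hab, MemWeighted φ γ.signature)
    (γ σ : UnparamPath V hab) : ℝ :=
  inner ℝ (weightedSignature φ hS γ) (weightedSignature φ hS σ)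

/-! ### Universal kernels -/

/-- A kernel on a topological space is (cc-)universal if it is jointly continuous, symmetric and
positive (semi)definite, and if for every compact `K` the linear span of the functions `k(γ, ·)`
with `γ ∈ K` is dense in `C(K)` for uniform convergence. (For compact `K` the topology of
`C(K, ℝ)` is that of uniform convergence.) -/
structure IsUniversalKernel {X : Type*} [TopologicalSpace X] (k : X → X → ℝ) : Prop where
  continuous : Continuous fun p : X × X => k p.1 p.2
  symm : ∀ γ σ, k γ σ = k σ γ
  posSemidef : ∀ (n : ℕ) (x : Fin n → X) (c : Fin n → ℝ),
    0 ≤ ∑ i, ∑ j, c i * c j * k (x i) (x j)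
  dense : ∀ K : Set X, IsCompact K →
    Dense (Submodule.span ℝ {f : C(K, ℝ) | ∃ γ ∈ K, ∀ σ : K, f σ = k γ σ} : Set C(K, ℝ))

end SigKernel

end

open SigKernel

noncomputable section

namespace SigKernel

open MeasureTheory Set Filter Topology

/-! ### Vector measures in finite dimension -/

/-! Membership in `T_φ((V))` is factorial decay: ‖S(x)^(k)‖ ≤ L^k / k!, with L the mass of |dx| on
(a, b], so the assumption on φ makes the weighted norm finite.

For density, call ⟨u, S(·)^(k)⟩ a coordinate function. By the shuffle identity a product of two
coordinate functions is again one, the constant 1 is the one of degree 0, and points of the quotient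
are separated because paths with equal signatures are identified. Stone–Weierstrass then makes the
span of the coordinate functions dense in C(K). Each of them equals ⟨w, S(·)⟩_φ with w concentrated
in one degree; replacing w by its projection onto the closed span of S(K) does not change it on K,
so it is a uniform limit of combinations of the k_φ(γ, ·) with γ ∈ K.

Decay and shuffle both come from first-order increments over short intervals (`HasIncrement`), not
from integrals over simplices. Such increments and an initial value determine a function
(`HasIncrement.eq_of_eq`) and obey the product rule (`HasIncrement.mul`). The errors are controlled
by the clock t ↦ |dx|((-∞, t]), continuous because dx has no atoms. -/

/-- A vector measure with values in a finite-dimensional inner product space has finite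
variation. -/
theorem isFiniteMeasure_variation {X V : Type*} [MeasurableSpace X] [NormedAddCommGroup V]
    [InnerProductSpace ℝ V] [FiniteDimensional ℝ V] (ν : VectorMeasure X V) :
    IsFiniteMeasure ν.variation := by
  let e := stdOrthonormalBasis ℝ V
  let c : Fin (Module.finrank ℝ V) → SignedMeasure X := fun i =>
    ν.mapRange (innerSL ℝ (e i)).toLinearMap.toAddMonoidHom (innerSL ℝ (e i)).continuous
  -- In an orthonormal basis ‖ν s‖ ≤ ∑ |c i s|, and each coordinate is a signed measure, hence of
  -- finite total variation.
  have hle : ν.variation ≤ ∑ i, (c i).totalVariation := by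
    refine VectorMeasure.variation_le_of_forall_enorm_le fun s _ => ?_
    calc ‖ν s‖ₑ = ‖∑ i, inner ℝ (e i) (ν s) • e i‖ₑ := by rw [e.sum_repr' (ν s)]
      _ ≤ ∑ i, ‖inner ℝ (e i) (ν s) • e i‖ₑ := enorm_sum_le _ _
      _ = ∑ i, ‖c i s‖ₑ := Finset.sum_congr rfl fun i _ => by
          have h1 : ‖e i‖ₑ = 1 := by
            rw [← ofReal_norm, e.orthonormal.1 i, ENNReal.ofReal_one]
          rw [enorm_smul, h1, mul_one]
          rfl
      _ ≤ ∑ i, (c i).totalVariation s :=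
          Finset.sum_le_sum fun i _ => SignedMeasure.enorm_le_totalVariation _ _
      _ = (∑ i, (c i).totalVariation) s := by simp
  have : ∀ i, IsFiniteMeasure (c i).totalVariation := fun i => by
    unfold SignedMeasure.totalVariation
    infer_instance
  exact isFiniteMeasure_of_le _ hle

theorem norm_setIntegral_Ioc_le {E F G : Type*} [NormedAddCommGroup E] [NormedSpace ℝ E]
    [NormedAddCommGroup F] [NormedSpace ℝ F] [NormedAddCommGroup G] [NormedSpace ℝ G]
    (ν : VectorMeasure ℝ F) [IsFiniteMeasure ν.variation] (B : E →L[ℝ] F →L[ℝ] G) {f : ℝ → E}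
    {C s t : ℝ} (h : ∀ r ∈ Ioc s t, ‖f r‖ ≤ C) :
    ‖(ν.restrict (Ioc s t)).integral f B‖ ≤ C * ‖B‖ * ν.variation.real (Ioc s t) := by
  have h1 : ∀ᵐ r ∂(ν.restrict (Ioc s t)).variation, ‖f r‖ ≤ C := by
    rw [VectorMeasure.variation_restrict measurableSet_Ioc]
    exact (ae_restrict_iff' measurableSet_Ioc).2 (Eventually.of_forall h)
  have h2 := VectorMeasure.norm_integral_le_of_norm_le_const (B := B) h1
  rwa [VectorMeasure.variation_restrict measurableSet_Ioc, measureReal_restrict_apply_univ] at h2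

/-! ### Increments -/

/-- If the increments of `H` over short intervals are at most those of `g`, up to a small multiple
of those of `m`, then the increment over the whole interval is at most that of `g`. -/
theorem norm_sub_le_of_forall_short {E : Type*} [NormedAddCommGroup E] {a b : ℝ} (hab : a ≤ b)
    {H : ℝ → E} {g m : ℝ → ℝ}
    (h : ∀ ε > 0, ∃ δ > 0, ∀ s ∈ Icc a b, ∀ t ∈ Icc a b, s ≤ t → t - s < δ →
      ‖H t - H s‖ ≤ g t - g s + ε * (m t - m s)) :
    ‖H b - H a‖ ≤ g b - g a := by
  have key : ∀ ε > 0, ‖H b - H a‖ ≤ g b - g a + ε * (m b - m a) := by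
    intro ε hε
    obtain ⟨δ, hδ, hs⟩ := h ε hε
    -- Induction on the number of steps back to `a`. Their length is δ / 2 because the hypothesis
    -- needs t - s < δ strictly.
    have step : ∀ n : ℕ, ∀ t ∈ Icc a b, t - a ≤ n * (δ / 2) →
        ‖H t - H a‖ ≤ g t - g a + ε * (m t - m a) := by
      intro n
      induction n with
      | zero =>
        intro t ht hn
        have : t = a := le_antisymm (by simpa using hn) ht.1
        simp [this]
      | succ n ih =>
        intro t ht hn
        push_cast at hn
        let s := max a (t - δ / 2)
        have hs1 : s ∈ Icc a b := ⟨le_max_left _ _, max_le hab (by linarith [ht.2])⟩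
        have hst : s ≤ t := max_le ht.1 (by linarith)
        have hs2 : s - a ≤ n * (δ / 2) := by
          rw [sub_le_iff_le_add]
          exact max_le (by nlinarith [Nat.cast_nonneg (α := ℝ) n]) (by linarith)
        have h1 := ih s hs1 hs2
        have h2 := hs s hs1 t ht hst (by linarith [le_max_right a (t - δ / 2)])
        calc ‖H t - H a‖ ≤ ‖H t - H s‖ + ‖H s - H a‖ := norm_sub_le_norm_sub_add_norm_sub _ _ _
          _ ≤ _ := by linarith
    obtain ⟨n, hn⟩ := exists_nat_ge ((b - a) / (δ / 2))
    exact step n b (right_mem_Icc.2 hab) ((div_le_iff₀ (by positivity)).1 hn)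
  refine le_of_forall_pos_le_add fun η hη => ?_
  have hp : 0 < |m b - m a| + 1 := by positivity
  refine (key (η / (|m b - m a| + 1)) (by positivity)).trans ?_
  have : η / (|m b - m a| + 1) * (m b - m a) ≤ η := by
    rw [div_mul_eq_mul_div, div_le_iff₀ hp]
    exact mul_le_mul_of_nonneg_left (by linarith [le_abs_self (m b - m a)]) hη.le
  linarith

theorem exists_short_norm_sub_le {E : Type*} [NormedAddCommGroup E] {F : ℝ → E} (hF : Continuous F) (a b : ℝ) {ε : ℝ}
    (hε : 0 < ε) :
    ∃ δ > 0, ∀ s ∈ Icc a b, ∀ t ∈ Icc a b, s ≤ t → t - s < δ → ‖F t - F s‖ ≤ ε := by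
  obtain ⟨δ, hδ, h⟩ := Metric.uniformContinuousOn_iff.1
    (isCompact_Icc.uniformContinuousOn_of_continuous (s := Icc a b) hF.continuousOn) ε hε
  refine ⟨δ, hδ, fun s hs t ht hst hd => ?_⟩
  rw [← dist_eq_norm]
  exact (h t ht s hs (by rwa [Real.dist_eq, abs_of_nonneg (sub_nonneg.2 hst)])).le

/-- Convexity: the graph of r ↦ r^(k+1) lies above its tangent at p. This is the discrete form of
(k+1) M^k dM = d(M^(k+1)) used for factorial decay. -/
theorem pow_mul_sub_le_pow_succ_sub {p q : ℝ} (hp : 0 ≤ p) (hpq : p ≤ q) (k : ℕ) :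
    (k + 1) * p ^ k * (q - p) ≤ q ^ (k + 1) - p ^ (k + 1) := by
  induction k with
  | zero => simp
  | succ k ih =>
    have h2 : p ^ (k + 1) ≤ q ^ (k + 1) := pow_le_pow_left₀ hp hpq _
    have h3 := mul_le_mul_of_nonneg_left ih hp
    have h4 := mul_le_mul_of_nonneg_right h2 (sub_nonneg.2 hpq)
    push_cast
    calc (k + 1 + 1) * p ^ (k + 1) * (q - p)
        = p * ((k + 1) * p ^ k * (q - p)) + p ^ (k + 1) * (q - p) := by ring
      _ ≤ p * (q ^ (k + 1) - p ^ (k + 1)) + q ^ (k + 1) * (q - p) := add_le_add h3 h4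
      _ = q ^ (k + 1 + 1) - p ^ (k + 1 + 1) := by ring

namespace BVPath

variable {V : Type u} [NormedAddCommGroup V] [InnerProductSpace ℝ V] [FiniteDimensional ℝ V]
  {a b : ℝ} {hab : a ≤ b}

instance (x : BVPath V hab) : IsFiniteMeasure x.measure.variation :=
  isFiniteMeasure_variation _

theorem continuous_extend {V : Type u} [NormedAddCommGroup V] {a b : ℝ} {hab : a ≤ b}
    (x : BVPath V hab) : Continuous x.extend :=
  x.continuous.Icc_extend'

theorem measure_singleton (x : BVPath V hab) (t : ℝ) : x.measure {t} = 0 := by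
  have : CompleteSpace V := FiniteDimensional.complete ℝ V
  unfold measure
  rw [BoundedVariationOn.vectorMeasure_singleton,
    x.continuous_extend.continuousAt.continuousWithinAt.rightLim_eq,
    x.continuous_extend.continuousAt.continuousWithinAt.leftLim_eq, sub_self]

instance (x : BVPath V hab) : NullSingletonClass x.measure.variation where
  measure_singleton t := by
    refine (VectorMeasure.variation_apply_eq_zero (measurableSet_singleton t)).2 fun s hs _ => ?_
    rcases subset_singleton_iff_eq.1 hs with rfl | rfl
    · simp
    · exact x.measure_singleton t

/-- The total variation of the path up to time `t`. -/
def clock (x : BVPath V hab) (t : ℝ) : ℝ := x.measure.variation.real (Iic t)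

theorem clock_sub (x : BVPath V hab) {s t : ℝ} (hst : s ≤ t) :
    x.measure.variation.real (Ioc s t) = x.clock t - x.clock s := by
  unfold clock
  rw [← Iic_union_Ioc_eq_Iic hst, measureReal_union (by
    rw [Set.disjoint_left]; intro r h1 h2; exact absurd h2.1 (not_lt.2 h1)) measurableSet_Ioc]
  ring

theorem clock_mono (x : BVPath V hab) : Monotone x.clock := fun _ _ h =>
  measureReal_mono (Iic_subset_Iic.2 h)

/-- Up to a constant the clock is the primitive of 1 against |dx|, which is continuous since |dx|
charges no point. -/
theorem continuous_clock (x : BVPath V hab) : Continuous x.clock := by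
  have h : Continuous fun t => ∫ _ in (0 : ℝ)..t, (1 : ℝ) ∂x.measure.variation :=
    intervalIntegral.continuous_primitive (fun _ _ => intervalIntegrable_const) 0
  have h' : x.clock = fun t => (∫ _ in (0 : ℝ)..t, (1 : ℝ) ∂x.measure.variation) + x.clock 0 := by
    funext t
    rcases le_total 0 t with ht | ht
    · rw [intervalIntegral.integral_of_le ht]
      simp [x.clock_sub ht]
    · rw [intervalIntegral.integral_of_ge ht]
      simp [x.clock_sub ht]
  rw [h']
  exact h.add continuous_const

/-! ### Indefinite integrals along a path -/

section Integral

variable {E G : Type*} [NormedAddCommGroup E] [NormedSpace ℝ E] [NormedAddCommGroup G]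
  [NormedSpace ℝ G]

/-- The indefinite integral `∫_a^t B(f, dx)`. -/
def primitive (x : BVPath V hab) (B : E →L[ℝ] V →L[ℝ] G) (f : ℝ → E) (t : ℝ) : G :=
  (x.measure.restrict (Ioc a t)).integral f B

variable (x : BVPath V hab) (B : E →L[ℝ] V →L[ℝ] G) {f : ℝ → E}

theorem integrableOn_of_continuous_of_bounded {E : Type*} [NormedAddCommGroup E] {f : ℝ → E}
    (hf : Continuous f) {C : ℝ} (hC : ∀ r, ‖f r‖ ≤ C) (s : Set ℝ) : x.measure.IntegrableOn f s := by
  have : x.measure.Integrable f := by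
    refine Integrable.of_bound (C := C) ?_ (Eventually.of_forall hC)
    exact hf.aestronglyMeasurable
  exact VectorMeasure.Integrable.integrableOn this

theorem primitive_of_le {t : ℝ} (ht : t ≤ a) : x.primitive B f t = 0 := by
  simp [primitive, Ioc_eq_empty (not_lt.2 ht)]

theorem primitive_sub (hf : Continuous f) {C : ℝ} (hC : ∀ r, ‖f r‖ ≤ C) {s t : ℝ} (hs : a ≤ s)
    (hst : s ≤ t) :
    x.primitive B f t - x.primitive B f s = (x.measure.restrict (Ioc s t)).integral f B := by
  have hi := x.integrableOn_of_continuous_of_bounded hf hC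
  unfold primitive
  rw [← Ioc_union_Ioc_eq_Ioc hs hst, VectorMeasure.setIntegral_union
    (Ioc_disjoint_Ioc_of_le le_rfl) measurableSet_Ioc measurableSet_Ioc (hi _) (hi _)]
  abel

theorem norm_primitive_sub_le_of_forall_mem (hf : Continuous f) {C : ℝ} (hC : ∀ r, ‖f r‖ ≤ C)
    {s t D : ℝ} (hs : a ≤ s) (hst : s ≤ t) (hD : ∀ r ∈ Ioc s t, ‖f r‖ ≤ D) :
    ‖x.primitive B f t - x.primitive B f s‖ ≤ D * ‖B‖ * (x.clock t - x.clock s) := by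
  rw [x.primitive_sub B hf hC hs hst, ← x.clock_sub hst]
  exact norm_setIntegral_Ioc_le _ _ hD

/-- Valid also for s < a, where the primitive vanishes; continuity on all of ℝ then needs no
separate treatment of the point a. -/
theorem norm_primitive_sub_le (hf : Continuous f) {C : ℝ} (hC : ∀ r, ‖f r‖ ≤ C) {s t : ℝ}
    (hst : s ≤ t) :
    ‖x.primitive B f t - x.primitive B f s‖ ≤ C * ‖B‖ * (x.clock t - x.clock s) := by
  have hC0 : 0 ≤ C := (norm_nonneg _).trans (hC 0)
  rcases le_total a s with hs | hs
  · exact x.norm_primitive_sub_le_of_forall_mem B hf hC hs hst fun r _ => hC r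
  · rcases le_total a t with ht | ht
    · rw [x.primitive_of_le B hs, ← x.primitive_of_le B le_rfl (f := f)]
      refine (x.norm_primitive_sub_le_of_forall_mem B hf hC le_rfl ht fun r _ => hC r).trans ?_
      exact mul_le_mul_of_nonneg_left (by linarith [x.clock_mono hs]) (by positivity)
    · rw [x.primitive_of_le B hs, x.primitive_of_le B ht, sub_self, norm_zero]
      exact mul_nonneg (by positivity) (sub_nonneg.2 (x.clock_mono hst))

theorem continuous_primitive (hf : Continuous f) {C : ℝ} (hC : ∀ r, ‖f r‖ ≤ C) :
    Continuous (x.primitive B f) := by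
  refine continuous_iff_continuousAt.2 fun t => ?_
  refine tendsto_iff_norm_sub_tendsto_zero.2 ?_
  have h : Tendsto (fun s => C * ‖B‖ * |x.clock s - x.clock t|) (𝓝 t) (𝓝 0) := by
    have : Continuous fun s => C * ‖B‖ * |x.clock s - x.clock t| :=
      continuous_const.mul (x.continuous_clock.sub continuous_const).abs
    simpa using this.tendsto t
  refine squeeze_zero (fun _ => norm_nonneg _) (fun s => ?_) h
  rcases le_total s t with hst | hst
  · rw [norm_sub_rev, abs_sub_comm, abs_of_nonneg (sub_nonneg.2 (x.clock_mono hst))]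
    exact x.norm_primitive_sub_le B hf hC hst
  · rw [abs_of_nonneg (sub_nonneg.2 (x.clock_mono hst))]
    exact x.norm_primitive_sub_le B hf hC hst

theorem norm_primitive_le {C : ℝ} (hC : ∀ r, ‖f r‖ ≤ C) (t : ℝ) :
    ‖x.primitive B f t‖ ≤ C * ‖B‖ * x.measure.variation.real univ := by
  have hC0 : 0 ≤ C := (norm_nonneg _).trans (hC 0)
  refine (norm_setIntegral_Ioc_le _ _ fun r _ => hC r).trans ?_
  exact mul_le_mul_of_nonneg_left (measureReal_mono (subset_univ _)) (by positivity)

end Integral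

/-! ### First-order calculus along dx -/

/-- `F` has increments `F_t - F_s = D_s (dx(s, t]) + o(1) |dx|(s, t]`. -/
def HasIncrement {E : Type*} [NormedAddCommGroup E] [NormedSpace ℝ E] (x : BVPath V hab)
    (F : ℝ → E) (D : ℝ → V →L[ℝ] E) : Prop :=
  ∀ ε > 0, ∃ δ > 0, ∀ s ∈ Icc a b, ∀ t ∈ Icc a b, s ≤ t → t - s < δ →
    ‖F t - F s - D s (x.measure (Ioc s t))‖ ≤ ε * (x.clock t - x.clock s)

section HasIncrement

variable {E E' G : Type*} [NormedAddCommGroup E] [NormedSpace ℝ E] [NormedAddCommGroup E']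
  [NormedSpace ℝ E'] [NormedAddCommGroup G] [NormedSpace ℝ G] {x : BVPath V hab}

/-- Freezing f at its left-end value on (s, t] costs at most the oscillation of f there, which
uniform continuity makes small, times ‖B‖ |dx|(s, t]. -/
theorem hasIncrement_primitive [CompleteSpace G] (x : BVPath V hab) (B : E →L[ℝ] V →L[ℝ] G)
    {f : ℝ → E} (hf : Continuous f) {C : ℝ} (hC : ∀ r, ‖f r‖ ≤ C) :
    x.HasIncrement (x.primitive B f) (fun s => B (f s)) := by
  intro ε hε
  obtain ⟨δ, hδ, h⟩ := exists_short_norm_sub_le hf a b (ε := ε / (‖B‖ + 1)) (by positivity)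
  refine ⟨δ, hδ, fun s hs t ht hst hd => ?_⟩
  have hi := x.integrableOn_of_continuous_of_bounded hf hC (Ioc s t)
  have hc := x.integrableOn_of_continuous_of_bounded (f := fun _ => f s) continuous_const
    (C := ‖f s‖) (fun _ => le_rfl) (Ioc s t)
  have h1 : B (f s) (x.measure (Ioc s t)) =
      (x.measure.restrict (Ioc s t)).integral (fun _ => f s) B := by
    rw [VectorMeasure.integral_const, VectorMeasure.restrict_apply _ measurableSet_Ioc
      MeasurableSet.univ, univ_inter]
  rw [x.primitive_sub B hf hC hs.1 hst, h1, ← VectorMeasure.integral_fun_sub hi hc]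
  refine (norm_setIntegral_Ioc_le (C := ε / (‖B‖ + 1)) _ _ fun r hr => ?_).trans ?_
  · exact h s hs r ⟨hs.1.trans hr.1.le, hr.2.trans ht.2⟩ hr.1.le (by linarith [hr.2])
  · rw [x.clock_sub hst]
    refine mul_le_mul_of_nonneg_right ?_ (sub_nonneg.2 (x.clock_mono hst))
    rw [div_mul_eq_mul_div, div_le_iff₀ (by positivity)]
    nlinarith [norm_nonneg B]

theorem HasIncrement.clm_comp {F : ℝ → E} {D : ℝ → V →L[ℝ] E} (h : x.HasIncrement F D)
    (L : E →L[ℝ] E') : x.HasIncrement (fun t => L (F t)) (fun s => L.comp (D s)) := by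
  intro ε hε
  obtain ⟨δ, hδ, h⟩ := h (ε / (‖L‖ + 1)) (by positivity)
  refine ⟨δ, hδ, fun s hs t ht hst hd => ?_⟩
  rw [ContinuousLinearMap.comp_apply, ← map_sub, ← map_sub]
  refine (L.le_opNorm _).trans ((mul_le_mul_of_nonneg_left (h s hs t ht hst hd)
    (norm_nonneg L)).trans ?_)
  rw [← mul_assoc]
  refine mul_le_mul_of_nonneg_right ?_ (sub_nonneg.2 (x.clock_mono hst))
  rw [mul_div_assoc', div_le_iff₀ (by positivity)]
  nlinarith [norm_nonneg L]

/-- A function is determined by its initial value and its infinitesimal increments. -/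
theorem HasIncrement.eq_of_eq {F F' : ℝ → E} {D D' : ℝ → V →L[ℝ] E} (h : x.HasIncrement F D)
    (h' : x.HasIncrement F' D') (hD : ∀ s ∈ Icc a b, D s = D' s) (ha : F a = F' a) {t : ℝ}
    (ht : t ∈ Icc a b) : F t = F' t := by
  -- The difference has increments o(1) |dx|, so it is compared with g = 0.
  have key : ‖(F t - F' t) - (F a - F' a)‖ ≤ 0 - 0 := by
    refine norm_sub_le_of_forall_short (H := fun r => F r - F' r) (g := fun _ => 0)
      (m := x.clock) ht.1 fun ε hε => ?_
    obtain ⟨δ, hδ, h1⟩ := h (ε / 2) (by positivity)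
    obtain ⟨δ', hδ', h2⟩ := h' (ε / 2) (by positivity)
    refine ⟨min δ δ', lt_min hδ hδ', fun s hs r hr hsr hd => ?_⟩
    have hs' : s ∈ Icc a b := ⟨hs.1, hs.2.trans ht.2⟩
    have hr' : r ∈ Icc a b := ⟨hr.1, hr.2.trans ht.2⟩
    have h3 := h1 s hs' r hr' hsr (hd.trans_le (min_le_left _ _))
    have h4 := h2 s hs' r hr' hsr (hd.trans_le (min_le_right _ _))
    have h5 : F r - F' r - (F s - F' s) = (F r - F s - D s (x.measure (Ioc s r))) -
        (F' r - F' s - D' s (x.measure (Ioc s r))) := by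
      rw [hD s hs']; abel
    calc ‖F r - F' r - (F s - F' s)‖ ≤ _ := h5 ▸ norm_sub_le _ _
      _ ≤ ε / 2 * (x.clock r - x.clock s) + ε / 2 * (x.clock r - x.clock s) := add_le_add h3 h4
      _ = 0 - 0 + ε * (x.clock r - x.clock s) := by ring
  rw [ha, sub_self, sub_zero, sub_zero] at key
  exact sub_eq_zero.1 (norm_le_zero_iff.1 key)

/-- The product rule (integration by parts). -/
theorem HasIncrement.mul {F F' : ℝ → ℝ} {D D' : ℝ → V →L[ℝ] ℝ} (h : x.HasIncrement F D)
    (h' : x.HasIncrement F' D') (hF : Continuous F) (hF' : Continuous F') {L : ℝ}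
    (hL : ∀ s t, s ≤ t → |F' t - F' s| ≤ L * (x.clock t - x.clock s)) :
    x.HasIncrement (fun t => F t * F' t) (fun s => F s • D' s + F' s • D s) := by
  intro ε hε
  obtain ⟨C, hC⟩ := isCompact_Icc.exists_bound_of_continuousOn (s := Icc a b) hF.continuousOn
  obtain ⟨C', hC'⟩ := isCompact_Icc.exists_bound_of_continuousOn (s := Icc a b) hF'.continuousOn
  have hN : 0 < |C| + |C'| + |L| + 1 := by positivity
  set N := |C| + |C'| + |L| + 1 with hNdef
  obtain ⟨δ₁, hδ₁, h1⟩ := h (ε / N) (by positivity)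
  obtain ⟨δ₂, hδ₂, h2⟩ := h' (ε / N) (by positivity)
  obtain ⟨δ₃, hδ₃, h3⟩ := exists_short_norm_sub_le hF a b (ε := ε / N) (by positivity)
  refine ⟨min δ₁ (min δ₂ δ₃), lt_min hδ₁ (lt_min hδ₂ hδ₃), fun s hs t ht hst hd => ?_⟩
  have i1 := h1 s hs t ht hst (hd.trans_le (min_le_left _ _))
  have i2 := h2 s hs t ht hst (hd.trans_le ((min_le_right _ _).trans (min_le_left _ _)))
  have i3 := h3 s hs t ht hst (hd.trans_le ((min_le_right _ _).trans (min_le_right _ _)))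
  have i4 := hL s t hst
  have hm := sub_nonneg.2 (x.clock_mono hst)
  set X := x.measure (Ioc s t)
  set m := x.clock t - x.clock s
  have hη : 0 < ε / N := by positivity
  have j1 : |F s| ≤ |C| := (hC s hs).trans (le_abs_self _)
  have j2 : |F' s| ≤ |C'| := (hC' s hs).trans (le_abs_self _)
  have j4 : |F' t - F' s| ≤ |L| * m := i4.trans (mul_le_mul_of_nonneg_right (le_abs_self _) hm)
  -- Discrete product rule. The last term is of second order: F t - F s is small by continuity and
  -- F' t - F' s is at most |L| m. The constant N collects the three error coefficients.
  have hsplit : F t * F' t - F s * F' s - (F s • D' s + F' s • D s) X =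
      F s * (F' t - F' s - D' s X) + F' s * (F t - F s - D s X) +
        (F t - F s) * (F' t - F' s) := by
    simp only [add_apply, smul_apply, smul_eq_mul]
    ring
  simp only [Real.norm_eq_abs] at i1 i2 i3 ⊢
  rw [hsplit]
  calc _ ≤ |F s * (F' t - F' s - D' s X)| + |F' s * (F t - F s - D s X)| +
        |(F t - F s) * (F' t - F' s)| := abs_add_three _ _ _
    _ ≤ |C| * (ε / N * m) + |C'| * (ε / N * m) + ε / N * (|L| * m) := by
      simp only [abs_mul]
      gcongr
    _ ≤ ε / N * N * m := by
      rw [hNdef]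
      nlinarith [mul_nonneg hη.le hm]
    _ = ε * m := by rw [div_mul_cancel₀ _ hN.ne']

end HasIncrement

/-! ### Iterated integrals -/

theorem norm_tpowSnoc_le (V : Type u) [NormedAddCommGroup V] [InnerProductSpace ℝ V] (k : ℕ) :
    ‖tpowSnoc V k‖ ≤ 1 := by
  refine ContinuousLinearMap.opNorm_le_bound₂ _ zero_le_one fun v w => ?_
  rw [one_mul, ← abs_of_nonneg (norm_nonneg (tpowSnoc V k v w)),
    ← abs_of_nonneg (mul_nonneg (norm_nonneg v) (norm_nonneg w)), ← sq_le_sq, mul_pow,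
    ← real_inner_self_eq_norm_sq, ← real_inner_self_eq_norm_sq, ← real_inner_self_eq_norm_sq,
    inner_tpowSnoc]

theorem norm_tpowOne (V : Type u) [NormedAddCommGroup V] [InnerProductSpace ℝ V] :
    ‖tpowOne V‖ = 1 := by
  have h := inner_tpowOne V
  rw [real_inner_self_eq_norm_sq] at h
  exact (pow_eq_one_iff_of_nonneg (norm_nonneg _) two_ne_zero).1 h

/-- The two properties go together in the induction: both are needed of the integrand to make its
primitive continuous. -/
theorem continuous_and_bounded_iteratedIntegral (x : BVPath V hab) (k : ℕ) :
    Continuous (x.iteratedIntegral k) ∧ ∃ C, ∀ t, ‖x.iteratedIntegral k t‖ ≤ C := by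
  induction k with
  | zero => exact ⟨continuous_const, ‖tpowOne V‖, fun t => le_rfl⟩
  | succ k ih =>
    obtain ⟨hc, C, hC⟩ := ih
    exact ⟨x.continuous_primitive _ hc hC, _, x.norm_primitive_le _ hC⟩

theorem continuous_iteratedIntegral (x : BVPath V hab) (k : ℕ) :
    Continuous (x.iteratedIntegral k) := (x.continuous_and_bounded_iteratedIntegral k).1

theorem iteratedIntegral_succ_left (x : BVPath V hab) (k : ℕ) :
    x.iteratedIntegral (k + 1) a = 0 := x.primitive_of_le _ le_rfl

theorem hasIncrement_iteratedIntegral (x : BVPath V hab) (k : ℕ) :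
    x.HasIncrement (x.iteratedIntegral (k + 1))
      (fun s => tpowSnoc V k (x.iteratedIntegral k s)) := by
  obtain ⟨hc, C, hC⟩ := x.continuous_and_bounded_iteratedIntegral k
  have : CompleteSpace (TPow V (k + 1)) := FiniteDimensional.complete ℝ _
  exact x.hasIncrement_primitive _ hc hC

theorem exists_norm_iteratedIntegral_sub_le (x : BVPath V hab) (k : ℕ) :
    ∃ L, ∀ s t, s ≤ t → ‖x.iteratedIntegral (k + 1) t - x.iteratedIntegral (k + 1) s‖ ≤
      L * (x.clock t - x.clock s) := by
  obtain ⟨hc, C, hC⟩ := x.continuous_and_bounded_iteratedIntegral k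
  exact ⟨_, fun s t hst => x.norm_primitive_sub_le _ hc hC hst⟩

/-- Factorial decay of the iterated integrals. -/
theorem norm_iteratedIntegral_le (x : BVPath V hab) (k : ℕ) {t : ℝ} (ht : a ≤ t) :
    ‖x.iteratedIntegral k t‖ ≤ (x.clock t - x.clock a) ^ k / k.factorial := by
  induction k generalizing t with
  | zero => simp [iteratedIntegral, norm_tpowOne]
  | succ k ih =>
    obtain ⟨hc, C, hC⟩ := x.continuous_and_bounded_iteratedIntegral k
    set M : ℝ → ℝ := fun r => x.clock r - x.clock a with hM
    have hMc : Continuous fun r => M r ^ k / k.factorial :=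
      ((x.continuous_clock.sub continuous_const).pow k).div_const _
    have hM0 : ∀ {r}, a ≤ r → 0 ≤ M r := fun h => sub_nonneg.2 (x.clock_mono h)
    have key := norm_sub_le_of_forall_short (H := x.iteratedIntegral (k + 1))
      (g := fun r => M r ^ (k + 1) / (k + 1).factorial) (m := x.clock) ht (fun ε hε => by
        obtain ⟨δ, hδ, h⟩ := exists_short_norm_sub_le hMc a t hε
        refine ⟨δ, hδ, fun s hs r hr hsr hd => ?_⟩
        have hm := sub_nonneg.2 (x.clock_mono hsr)
        have hMsr : M s ≤ M r := sub_le_sub_right (x.clock_mono hsr) _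
        -- On (s, r] the induction hypothesis is used at the right end, as M is monotone. `h4` moves
        -- the bound to the left end at the price of ε, where the tangent inequality applies.
        have h1 : ‖x.iteratedIntegral (k + 1) r - x.iteratedIntegral (k + 1) s‖ ≤
            M r ^ k / k.factorial * (x.clock r - x.clock s) := by
          have h2 := x.norm_primitive_sub_le_of_forall_mem (tpowSnoc V k) hc hC hs.1 hsr
            (D := M r ^ k / k.factorial) fun q hq => (ih (hs.1.trans hq.1.le)).trans (by
              have := hM0 (hs.1.trans hq.1.le)
              have : M q ≤ M r := sub_le_sub_right (x.clock_mono hq.2) _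
              gcongr)
          refine h2.trans (mul_le_mul_of_nonneg_right ?_ hm)
          have h3 : 0 ≤ M r ^ k / k.factorial :=
            div_nonneg (pow_nonneg (hM0 hr.1) _) (Nat.cast_nonneg _)
          exact mul_le_of_le_one_right h3 (norm_tpowSnoc_le V k)
        have h4 : M r ^ k / k.factorial ≤ M s ^ k / k.factorial + ε := by
          have := (le_abs_self _).trans (h s hs r hr hsr hd)
          linarith
        have h5 : M s ^ k / k.factorial * (x.clock r - x.clock s) ≤
            M r ^ (k + 1) / (k + 1).factorial - M s ^ (k + 1) / (k + 1).factorial := by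
          have h6 := pow_mul_sub_le_pow_succ_sub (hM0 hs.1) hMsr k
          have h7 : M r - M s = x.clock r - x.clock s := by simp only [hM]; ring
          rw [← h7, ← sub_div, Nat.factorial_succ, Nat.cast_mul, div_mul_eq_mul_div,
            div_le_div_iff₀ (by positivity) (by positivity)]
          push_cast
          have h8 : (0 : ℝ) ≤ k.factorial := Nat.cast_nonneg _
          nlinarith [mul_le_mul_of_nonneg_right h6 h8]
        calc _ ≤ _ := h1
          _ ≤ (M s ^ k / k.factorial + ε) * (x.clock r - x.clock s) :=
              mul_le_mul_of_nonneg_right h4 hm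
          _ ≤ _ := by rw [add_mul]; linarith)
    rw [x.iteratedIntegral_succ_left, sub_zero] at key
    simpa [hM] using key

/-- The shuffle identity: a product of two linear functionals of the signature is a linear
functional of the signature. -/
theorem exists_inner_mul_inner_eq (V : Type u) [NormedAddCommGroup V] [InnerProductSpace ℝ V]
    [FiniteDimensional ℝ V] {a b : ℝ} (hab : a ≤ b) (n : ℕ) :
    ∀ (k l : ℕ), k + l = n → ∀ (u : TPow V k) (v : TPow V l), ∃ w : TPow V n,
      ∀ (x : BVPath V hab), ∀ t ∈ Icc a b,
        inner ℝ u (x.iteratedIntegral k t) * inner ℝ v (x.iteratedIntegral l t) =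
          inner ℝ w (x.iteratedIntegral n t) := by
  induction n with
  | zero =>
    intro k l hkl u v
    obtain ⟨rfl, rfl⟩ : k = 0 ∧ l = 0 := by omega
    refine ⟨inner ℝ u (tpowOne V) • v, fun x t _ => ?_⟩
    simp only [iteratedIntegral, real_inner_smul_left]
  | succ n ih =>
    intro k l hkl u v
    rcases k with _ | k
    · obtain rfl : l = n + 1 := by omega
      refine ⟨inner ℝ u (tpowOne V) • v, fun x t _ => ?_⟩
      rw [real_inner_smul_left]
      rfl
    rcases l with _ | l
    · obtain rfl : k = n := by omega
      refine ⟨inner ℝ v (tpowOne V) • u, fun x t _ => ?_⟩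
      rw [real_inner_smul_left, mul_comm]
      rfl
    -- Contraction of the last tensor slot with e: the adjoint of p ↦ p ⊗ e.
    have slice : ∀ (k : ℕ) (u : TPow V (k + 1)) (e : V), ∃ u' : TPow V k, ∀ p,
        inner ℝ u (tpowSnoc V k p e) = inner ℝ u' p := fun k u e => by
      have : CompleteSpace (TPow V k) := FiniteDimensional.complete ℝ _
      have : CompleteSpace (TPow V (k + 1)) := FiniteDimensional.complete ℝ _
      exact ⟨ContinuousLinearMap.adjoint ((tpowSnoc V k).flip e) u, fun p => by
        rw [ContinuousLinearMap.adjoint_inner_left, ContinuousLinearMap.flip_apply]⟩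
    let e := stdOrthonormalBasis ℝ V
    choose u' hu' using fun i => slice k u (e i)
    choose v' hv' using fun i => slice l v (e i)
    choose w₁ hw₁ using fun i => ih k (l + 1) (by omega) (u' i) v
    choose w₂ hw₂ using fun i => ih (k + 1) l (by omega) u (v' i)
    -- The recursive shuffle product: in d(FG) = F dG + G dF the coefficient of the i-th component
    -- of dx is a sum of two products of total degree n, which the induction hypothesis represents
    -- by `w₂ i` and `w₁ i`.
    refine ⟨∑ i, tpowSnoc V n (w₁ i + w₂ i) (e i), fun x t ht => ?_⟩
    have hF := (x.hasIncrement_iteratedIntegral k).clm_comp (innerSL ℝ u)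
    have hG := (x.hasIncrement_iteratedIntegral l).clm_comp (innerSL ℝ v)
    have hW := (x.hasIncrement_iteratedIntegral n).clm_comp
      (innerSL ℝ (∑ i, tpowSnoc V n (w₁ i + w₂ i) (e i)))
    obtain ⟨L, hL⟩ := x.exists_norm_iteratedIntegral_sub_le l
    have hprod := hF.mul hG
      ((innerSL ℝ u).continuous.comp (x.continuous_iteratedIntegral _))
      ((innerSL ℝ v).continuous.comp (x.continuous_iteratedIntegral _))
      (L := ‖v‖ * L) (fun s t hst => by
        rw [← map_sub, innerSL_apply_apply, mul_assoc]
        exact (abs_real_inner_le_norm _ _).trans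
          (mul_le_mul_of_nonneg_left (hL s t hst) (norm_nonneg v)))
    -- Both sides vanish at a, and their differentials agree on each basis vector.
    refine hprod.eq_of_eq hW (fun s hs => ?_) ?_ ht
    · refine ContinuousLinearMap.coe_injective (e.toBasis.ext fun i => ?_)
      have horth : ∀ j, inner ℝ (e j) (e i) = if j = i then (1 : ℝ) else 0 :=
        fun j => orthonormal_iff_ite.1 e.orthonormal j i
      simp only [e.coe_toBasis, ContinuousLinearMap.coe_coe, add_apply, smul_apply,
        ContinuousLinearMap.comp_apply, innerSL_apply_apply, smul_eq_mul, sum_inner,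
        inner_tpowSnoc, horth, mul_ite, mul_one, mul_zero, Finset.sum_ite_eq', Finset.mem_univ,
        if_true, inner_add_left, hu', hv', ← hw₁ i x s hs, ← hw₂ i x s hs]
      ring
    · simp [iteratedIntegral_succ_left]

end BVPath

end SigKernel

end
noncomputable section

namespace SigKernel

open Set Topology

/-! ### Density -/

section Representer

variable {X E : Type*} [TopologicalSpace X] [CompactSpace X] [NormedAddCommGroup E]
  [InnerProductSpace ℝ E]

/-- The map `w ↦ ⟪w, Φ(·)⟫`. -/
def innerPullback (Φ : C(X, E)) : E →L[ℝ] C(X, ℝ) :=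
  LinearMap.mkContinuous
    { toFun := fun w => ⟨fun x => inner ℝ w (Φ x), continuous_const.inner Φ.continuous⟩
      map_add' := fun _ _ => ContinuousMap.ext fun _ => inner_add_left _ _ _
      map_smul' := fun _ _ => ContinuousMap.ext fun _ => real_inner_smul_left _ _ _ }
    ‖Φ‖ fun w => (ContinuousMap.norm_le _ (by positivity)).2 fun x =>
      (norm_inner_le_norm _ _).trans <| by
        rw [mul_comm]
        exact mul_le_mul_of_nonneg_right (Φ.norm_coe_le_norm x) (norm_nonneg _)

@[simp] theorem innerPullback_apply (Φ : C(X, E)) (w : E) (x : X) :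
    innerPullback Φ w x = inner ℝ w (Φ x) := rfl

/-- Only the projection of w onto the closed span of Φ(X) is seen by the pairing, and the bounded
map `innerPullback Φ` carries limits of that span to uniform limits. -/
theorem innerPullback_mem_closure_span_of_complete [CompleteSpace E] (Φ : C(X, E)) (w : E) :
    innerPullback Φ w ∈
      (Submodule.span ℝ (range fun y => innerPullback Φ (Φ y))).topologicalClosure := by
  let H : Submodule ℝ E := (Submodule.span ℝ (range Φ)).topologicalClosure
  have : CompleteSpace H := (Submodule.isClosed_topologicalClosure _).completeSpace_coe
  have hw : innerPullback Φ w = innerPullback Φ (H.starProjection w) := by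
    ext x
    have hx : Φ x ∈ H := Submodule.le_topologicalClosure _ (Submodule.subset_span ⟨x, rfl⟩)
    have := Submodule.starProjection_inner_eq_zero (K := H) w (Φ x) hx
    rw [inner_sub_left, sub_eq_zero] at this
    exact this
  have hP : H.starProjection w ∈ closure (Submodule.span ℝ (range Φ) : Set E) :=
    Submodule.starProjection_apply_mem H w
  have h := image_closure_subset_closure_image (innerPullback Φ).continuous ⟨_, hP, rfl⟩
  rw [hw]
  refine closure_mono ?_ h
  rintro _ ⟨v, hv, rfl⟩
  have h2 : (innerPullback Φ : E →ₗ[ℝ] C(X, ℝ)) v ∈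
      (Submodule.span ℝ (range Φ)).map (innerPullback Φ : E →ₗ[ℝ] C(X, ℝ)) :=
    Submodule.mem_map_of_mem hv
  rw [Submodule.map_span, ← range_comp] at h2
  exact h2

/-- On a compact space, every function `⟪w, Φ(·)⟫` is a uniform limit of linear combinations of
the functions `⟪Φ(y), Φ(·)⟫`. -/
theorem innerPullback_mem_closure_span (Φ : C(X, E)) (w : E) :
    innerPullback Φ w ∈
      (Submodule.span ℝ (range fun y => innerPullback Φ (Φ y))).topologicalClosure := by
  -- Embedding E in its completion preserves inner products, hence every function involved, and
  -- supplies the projection.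
  let Ψ : C(X, UniformSpace.Completion E) :=
    ⟨fun x => (Φ x : UniformSpace.Completion E),
      (UniformSpace.Completion.continuous_coe E).comp Φ.continuous⟩
  have h : ∀ v : E, innerPullback Ψ (v : UniformSpace.Completion E) = innerPullback Φ v :=
    fun v => ContinuousMap.ext fun x => UniformSpace.Completion.inner_coe v (Φ x)
  have h1 := innerPullback_mem_closure_span_of_complete Ψ w
  have h2 : (fun y => innerPullback Ψ (Ψ y)) = fun y => innerPullback Φ (Φ y) :=
    funext fun y => h (Φ y)
  rwa [h, h2] at h1

end Representer

/-! ### Coordinate functionals on the weighted space -/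

namespace WeightedTensors

variable {V : Type u} [NormedAddCommGroup V] [InnerProductSpace ℝ V]

/-- The tensor series concentrated in degree `k` which represents `v ↦ ⟪u, v_k⟫` in `T_φ((V))`. -/
theorem exists_inner_eq_inner_coeff (φ : Weight) (k : ℕ) (u : TPow V k) :
    ∃ w : WeightedTensors V φ, ∀ v : WeightedTensors V φ,
      inner ℝ w v = inner ℝ u (v.coeff k) := by
  classical
  -- The factor (φ k)⁻¹ cancels the weight in the φ-inner product.
  let s : TensorSeries V := Pi.single (M := fun j => TPow V j) k ((φ k)⁻¹ • u)
  have hk : s k = (φ k)⁻¹ • u := Pi.single_eq_same _ _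
  have hne : ∀ j, j ≠ k → s j = 0 := fun j hj => Pi.single_eq_of_ne hj _
  have hmem : MemWeighted φ s := summable_of_ne_finset_zero (s := {k}) fun j hj => by
    rw [hne j (by simpa using hj)]
    simp
  refine ⟨mk s hmem, fun v => ?_⟩
  rw [inner_def, tsum_eq_single k fun j hj => by rw [coeff_mk, hne j hj]; simp,
    coeff_mk, hk, real_inner_smul_left, mul_inv_cancel_left₀ (φ.pos k).ne']

end WeightedTensors

/-! ### Signatures in the weighted space and universality -/

variable {V : Type u} [NormedAddCommGroup V] [InnerProductSpace ℝ V] [FiniteDimensional ℝ V]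
  {a b : ℝ} {hab : a ≤ b}

/-- The signature of a path of bounded variation lies in `T_φ((V))`. -/
theorem UnparamPath.memWeighted_signature (φ : Weight)
    (hφ : ∀ C : ℝ, 0 < C → Summable fun k : ℕ => C ^ k * φ k / (k.factorial : ℝ) ^ 2)
    (γ : UnparamPath V hab) : MemWeighted φ γ.signature := by
  induction γ using Quotient.inductionOn with
  | h x =>
    set M := x.clock b - x.clock a
    have hM : 0 ≤ M := sub_nonneg.2 (x.clock_mono hab)
    -- The constant M² + 1 replaces M², which vanishes for the zero path, because `hφ` wants C > 0.
    refine Summable.of_nonneg_of_le (fun k => ?_) (fun k => ?_) (hφ (M ^ 2 + 1) (by positivity))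
    · have := φ.pos k
      positivity
    · have h0 := φ.pos k
      have h1 : ‖x.iteratedIntegral k b‖ ≤ M ^ k / k.factorial := x.norm_iteratedIntegral_le k hab
      calc φ k * ‖x.iteratedIntegral k b‖ ^ 2 ≤ φ k * (M ^ k / k.factorial) ^ 2 := by gcongr
        _ = (M ^ 2) ^ k * φ k / (k.factorial : ℝ) ^ 2 := by
          rw [div_pow, ← pow_mul, ← pow_mul, mul_comm k 2, mul_comm (φ k), div_mul_eq_mul_div]
        _ ≤ (M ^ 2 + 1) ^ k * φ k / (k.factorial : ℝ) ^ 2 := by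
          gcongr
          linarith

theorem UnparamPath.signature_injective :
    Function.Injective (UnparamPath.signature : UnparamPath V hab → TensorSeries V) := by
  intro γ σ h
  induction γ using Quotient.inductionOn
  induction σ using Quotient.inductionOn
  exact Quotient.sound h

theorem UnparamPath.signature_zero (γ : UnparamPath V hab) : γ.signature 0 = tpowOne V := by
  induction γ using Quotient.inductionOn
  rfl

theorem UnparamPath.exists_inner_mul_inner_eq (hab : a ≤ b) {k l : ℕ} (u : TPow V k)
    (v : TPow V l) : ∃ w : TPow V (k + l), ∀ γ : UnparamPath V hab,
      inner ℝ u (γ.signature k) * inner ℝ v (γ.signature l) =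
        inner ℝ w (γ.signature (k + l)) := by
  obtain ⟨w, hw⟩ := BVPath.exists_inner_mul_inner_eq V hab (k + l) k l rfl u v
  refine ⟨w, fun γ => ?_⟩
  induction γ using Quotient.inductionOn with
  | h x => exact hw x b (right_mem_Icc.2 hab)

/-- The coordinate functions of the signature span a dense subspace of `C(K)`. -/
theorem span_signature_coordinates_dense [TopologicalSpace (UnparamPath V hab)]
    (K : Set (UnparamPath V hab)) [CompactSpace K]
    (hcont : ∀ (k : ℕ) (u : TPow V k), Continuous fun γ : UnparamPath V hab =>
      inner ℝ u (γ.signature k)) :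
    (Submodule.span ℝ {f : C(K, ℝ) | ∃ (k : ℕ) (u : TPow V k), ∀ σ : K,
      f σ = inner ℝ u (σ.1.signature k)}).topologicalClosure = ⊤ := by
  -- Since the coordinate functions are closed under products by the shuffle identity, the algebra
  -- they generate is just their linear span.
  let G : Submonoid C(K, ℝ) :=
    { carrier := {f | ∃ (k : ℕ) (u : TPow V k), ∀ σ : K, f σ = inner ℝ u (σ.1.signature k)}
      one_mem' := ⟨0, tpowOne V, fun σ => by
        rw [UnparamPath.signature_zero, inner_tpowOne]; rfl⟩
      mul_mem' := by
        rintro f g ⟨k, u, hf⟩ ⟨l, v, hg⟩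
        obtain ⟨w, hw⟩ := UnparamPath.exists_inner_mul_inner_eq hab u v
        exact ⟨k + l, w, fun σ => by rw [ContinuousMap.mul_apply, hf, hg, hw]⟩ }
  have hsep : (Algebra.adjoin ℝ (G : Set C(K, ℝ))).SeparatesPoints := by
    intro γ σ hne
    have h1 : γ.1.signature ≠ σ.1.signature := fun h =>
      hne (Subtype.ext (UnparamPath.signature_injective h))
    obtain ⟨k, hk⟩ := Function.ne_iff.1 h1
    -- Pairing with the difference itself separates: equal values would give ⟨u, u⟩ = 0.
    let u : TPow V k := γ.1.signature k - σ.1.signature k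
    refine ⟨_, ⟨⟨fun τ : K => inner ℝ u (τ.1.signature k),
      (hcont k u).comp continuous_subtype_val⟩, Algebra.subset_adjoin ⟨k, u, fun _ => rfl⟩,
      rfl⟩, fun h => hk ?_⟩
    have h2 : inner ℝ u (γ.1.signature k) = inner ℝ u (σ.1.signature k) := h
    have h3 : inner ℝ u u = 0 := by
      conv_lhs => rw [show u = γ.1.signature k - σ.1.signature k from rfl, inner_sub_right]
      exact sub_eq_zero.2 h2
    exact sub_eq_zero.1 (inner_self_eq_zero.1 h3)
  have htop := ContinuousMap.subalgebra_topologicalClosure_eq_top_of_separatesPoints _ hsep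
  have hspan : Subalgebra.toSubmodule (Algebra.adjoin ℝ (G : Set C(K, ℝ))) =
      Submodule.span ℝ (G : Set C(K, ℝ)) := by
    rw [Algebra.adjoin_eq_span, Submonoid.closure_eq]
  refine SetLike.coe_injective ?_
  change closure ((Submodule.span ℝ (G : Set C(K, ℝ)) : Submodule ℝ C(K, ℝ)) : Set C(K, ℝ)) = univ
  rw [← hspan]
  exact congrArg (SetLike.coe) htop

/-- Continuity of the signature transform implies universality of the signature kernel. -/
theorem isUniversalKernel_signatureKernel [TopologicalSpace (UnparamPath V hab)] (φ : Weight)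
    (hS : ∀ γ : UnparamPath V hab, MemWeighted φ γ.signature)
    (hc : Continuous (weightedSignature φ hS)) : IsUniversalKernel (signatureKernel φ hS) where
  continuous := (hc.comp continuous_fst).inner (hc.comp continuous_snd)
  symm γ σ := real_inner_comm _ _
  posSemidef n x c := by
    have h : ∑ i, ∑ j, c i * c j * signatureKernel φ hS (x i) (x j) =
        inner ℝ (∑ i, c i • weightedSignature φ hS (x i))
          (∑ i, c i • weightedSignature φ hS (x i)) := by
      simp only [sum_inner, inner_sum, real_inner_smul_left, real_inner_smul_right,
        signatureKernel, mul_assoc]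
      exact Finset.sum_comm.trans (Finset.sum_congr rfl fun i _ =>
        Finset.sum_congr rfl fun j _ => mul_left_comm _ _ _)
    rw [h]
    exact real_inner_self_nonneg
  dense K hK := by
    have : CompactSpace K := isCompact_iff_compactSpace.1 hK
    let Φ : C(K, WeightedTensors V φ) :=
      ⟨fun σ => weightedSignature φ hS σ.1, hc.comp continuous_subtype_val⟩
    have hcoord : ∀ (k : ℕ) (u : TPow V k), ∃ w : WeightedTensors V φ, ∀ γ : UnparamPath V hab,
        inner ℝ w (weightedSignature φ hS γ) = inner ℝ u (γ.signature k) := fun k u => by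
      obtain ⟨w, hw⟩ := WeightedTensors.exists_inner_eq_inner_coeff φ k u
      exact ⟨w, fun γ => hw _⟩
    have hdense := span_signature_coordinates_dense K fun k u => by
      obtain ⟨w, hw⟩ := hcoord k u
      simp only [← hw]
      exact continuous_const.inner hc
    have hset : {f : C(K, ℝ) | ∃ γ ∈ K, ∀ σ : K, f σ = signatureKernel φ hS γ σ} =
        range fun y => innerPullback Φ (Φ y) := by
      ext f
      constructor
      · rintro ⟨γ, hγ, hf⟩
        exact ⟨⟨γ, hγ⟩, ContinuousMap.ext fun σ => (hf σ).symm⟩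
      · rintro ⟨γ, rfl⟩
        exact ⟨γ.1, γ.2, fun σ => rfl⟩
    -- The closed span of the kernel sections is everything as soon as it contains each coordinate
    -- function.
    rw [Submodule.dense_iff_topologicalClosure_eq_top, hset, eq_top_iff, ← hdense]
    refine Submodule.topologicalClosure_minimal _ (Submodule.span_le.2 ?_)
      (Submodule.isClosed_topologicalClosure _)
    rintro f ⟨k, u, hf⟩
    obtain ⟨w, hw⟩ := hcoord k u
    have : f = innerPullback Φ w := ContinuousMap.ext fun σ => (hf σ).trans (hw σ).symm
    rw [this]
    exact innerPullback_mem_closure_span Φ w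

end SigKernel

end

open SigKernel
theorem mainTheorem6 {V : Type u} [NormedAddCommGroup V] [InnerProductSpace ℝ V]
    [FiniteDimensional ℝ V] {a b : ℝ} (hab : a ≤ b) (φ : Weight)
    (hφ : ∀ C : ℝ, 0 < C → Summable fun k : ℕ => C ^ k * φ k / (k.factorial : ℝ) ^ 2)
    [TopologicalSpace (UnparamPath V hab)] :
    ∃ hS : ∀ γ : UnparamPath V hab, MemWeighted φ γ.signature,
      Continuous (weightedSignature φ hS) → IsUniversalKernel (signatureKernel φ hS) :=
  ⟨UnparamPath.memWeighted_signature φ hφ, isUniversalKernel_signatureKernel φ _⟩
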